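/- Conventions. $H$ is a locally compact Hausdorff topological group, $X$ a locally compact Hausdorff space. An upper semicontinuous $C^*$-bundle $\mathbf B$ over a topological space $X$ is a topological space $B$ with a continuous open surjection $p:B\to X$ and a $C^*$-algebra structure on each fibre $B_x=p^{-1}(x)$ such that $b\mapsto\|b\|$ is upper semicontinuous, $(a,b)\mapsto a+b$ and $(a,b)\mapsto ab$ are continuous on $\{(a,b): p(a)=p(b)\}$, $b\mapsto\lambda b$ ($\lambda\in\mathbb C$) and $b\mapsto b^*$ are continuous, and every net $(b_i)$ in $B$ with $p(b_i)\to x$ and $\|b_i\|\to0$ converges to $0_x$. Write $C_b(\mathbf B)$ for its bounded continuous sections and $C_0(\mathbf B)$ for its continuous sections $f$ such that $\{x:\|f(x)\|\ge\varepsilon\}$ is compact for all $\varepsilon>0$, with pointwise operations and the supremum norm. A partial action of $H$ on a set $X$ consists of subsets $X_t\subseteq X$ and bijections $\alpha_t:X_{t^{-1}}\to X_t$ ($t\in H$) with $X_e=X$, $\alpha_e=\mathrm{id}$, and such that $x\in X_{t^{-1}}$, $\alpha_t(x)\in X_{s^{-1}}$ imply $x\in X_{(st)^{-1}}$ and $\alpha_{st}(x)=\alpha_s(\alpha_t(x))$.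 On a topological space it is continuous if $\Gamma=\{(t,x):x\in X_{t^{-1}}\}$ is open in $H\times X$ and $(t,x)\mapsto\alpha_t(x)$ is continuous on $\Gamma$; it is free if $\alpha_t(x)=x$ implies $t=e$, and proper if preimages of compact sets under $\Gamma\to X\times X$, $(t,x)\mapsto(x,\alpha_t(x))$, are compact. A morphism of partial actions is a continuous map $f$ with $f(X_t)\subseteq Y_t$ and $\beta_t(f(x))=f(\alpha_t(x))$ for $x\in X_{t^{-1}}$. The orbit of $x$ is $Hx=\{\alpha_t(x):x\in X_{t^{-1}}\}$, and the orbit space $X/H$ has the quotient topology. A partial action $\alpha$ of $H$ on the bundle $\mathbf B$ is a pair of continuous partial actions, $\alpha$ on $B$ (with $\alpha_t:{}_{t^{-1}}B\to{}_tB$) and $\cdot$ on $X$, such that $p^{-1}(X_t)={}_tB$ for all $t$, $p$ is a morphism, and each $\alpha_t$ restricts to $*$-homomorphisms $B_x\to B_{t\cdot x}$ ($x\in X_{t^{-1}}$). It is free, respectively proper, if the partial action on $X$ is. **Theorem.** Let $\alpha$ be a free and proper partial action of $H$ on an upper semicontinuous $C^*$-bundle $\mathbf B$ over $X$, and let $p_\alpha:B/H\to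 X/H$, $Hb\mapsto Hp(b)$. (1) For each $x\in X$, $b\mapsto Hb$ is a bijection $h_x$ from $B_x$ onto $p_\alpha^{-1}(Hx)$, and the fibres of $p_\alpha$ carry $C^*$-algebra structures for which every $h_x$ is an isomorphism of $C^*$-algebras. With these structures $\mathbf B/H=(B/H,X/H,p_\alpha)$ is an upper semicontinuous $C^*$-bundle. (2) Let $\mathrm{Ind}_b(\mathbf B,\alpha)$ be the set of all $f\in C_b(\mathbf B)$ that are morphisms of partial actions from $X$ to $B$. It is a $C^*$-subalgebra of $C_b(\mathbf B)$, $C_b(\mathbf B/H)$ is a $C^*$-algebra, and $$\mathrm{Ind}_b:\mathrm{Ind}_b(\mathbf B,\alpha)\to C_b(\mathbf B/H),\qquad \mathrm{Ind}_b(f)(Hx)=Hf(x),$$ is well defined and an (isometric) isomorphism of $C^*$-algebras. (3) Let $\mathrm{Ind}_0(\mathbf B,\alpha)$ be the preimage of $C_0(\mathbf B/H)$ under $\mathrm{Ind}_b$. It is a $C^*$-subalgebra of $\mathrm{Ind}_b(\mathbf B,\alpha)$, $C_0(\mathbf B/H)$ is a $C^*$-algebra, and the restriction $\mathrm{Ind}_0:\mathrm{Ind}_0(\mathbf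 B,\alpha)\to C_0(\mathbf B/H)$ of $\mathrm{Ind}_b$ is an (isometric) isomorphism of $C^*$-algebras. -/

import Mathlib

open Filter Topology
open scoped ENNReal

noncomputable section

/-! ### Partial actions on topological spaces -/

/-- A partial action of a group `H` on a set `X`: subsets `dom t` (usually written `X_t`) and
bijections `act t : X_{t⁻¹} → X_t`.  The value of `act t` outside `X_{t⁻¹}` carries no information
and is never used. -/
structure PartialAction (H X : Type*) [Group H] where
  dom : H → Set X
  act : H → X → X
  dom_one : dom 1 = Set.univ
  bijOn : ∀ t, Set.BijOn (act t) (dom t⁻¹) (dom t)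
  act_one : ∀ x, act 1 x = x
  act_mul : ∀ s t x, x ∈ dom t⁻¹ → act t x ∈ dom s⁻¹ →
    x ∈ dom (s * t)⁻¹ ∧ act (s * t) x = act s (act t x)

namespace PartialAction

variable {H X Y : Type*} [Group H]

/-- The domain `Γ = {(t, x) | x ∈ X_{t⁻¹}}` of a partial action. -/
def graphDomain (α : PartialAction H X) : Set (H × X) := {q | q.2 ∈ α.dom q.1⁻¹}

/-- A partial action is continuous if `Γ` is open and `(t, x) ↦ α_t(x)` is continuous on `Γ`. -/
structure IsContinuous [TopologicalSpace H] [TopologicalSpace X] (α : PartialAction H X) :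
    Prop where
  isOpen_graphDomain : IsOpen α.graphDomain
  continuousOn : ContinuousOn (fun q : H × X => α.act q.1 q.2) α.graphDomain

/-- A partial action is free if all stabilizers are trivial. -/
class IsFree (α : PartialAction H X) : Prop where
  eq_one : ∀ (t : H) (x : X), x ∈ α.dom t⁻¹ → α.act t x = x → t = 1

/-- A partial action is proper if preimages of compact sets under
`Γ → X × X`, `(t, x) ↦ (x, α_t(x))`, are compact. -/
def IsProper [TopologicalSpace H] [TopologicalSpace X] (α : PartialAction H X) : Prop :=
  ∀ K : Set (X × X), IsCompact K →
    IsCompact {q : H × X | q ∈ α.graphDomain ∧ (q.2, α.act q.1 q.2) ∈ K}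

/-- Morphisms of partial actions. -/
structure IsMorphism [TopologicalSpace X] [TopologicalSpace Y]
    (α : PartialAction H X) (β : PartialAction H Y) (f : X → Y) : Prop where
  continuous : Continuous f
  mapsTo : ∀ t, Set.MapsTo f (α.dom t) (β.dom t)
  map_act : ∀ t, ∀ x ∈ α.dom t⁻¹, β.act t (f x) = f (α.act t x)

theorem act_mem (α : PartialAction H X) {t : H} {x : X} (hx : x ∈ α.dom t⁻¹) :
    α.act t x ∈ α.dom t := (α.bijOn t).mapsTo hx

theorem act_mem_inv (α : PartialAction H X) {t : H} {x : X} (hx : x ∈ α.dom t⁻¹) :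
    α.act t x ∈ α.dom t⁻¹⁻¹ := by
  rw [inv_inv]; exact α.act_mem hx

theorem act_inv_act (α : PartialAction H X) {t : H} {x : X} (hx : x ∈ α.dom t⁻¹) :
    α.act t⁻¹ (α.act t x) = x := by
  rw [← (α.act_mul t⁻¹ t x hx (α.act_mem_inv hx)).2, inv_mul_cancel, α.act_one]

/-- Two points are equivalent if they lie on the same orbit. -/
def orbitSetoid (α : PartialAction H X) : Setoid X where
  r x y := ∃ t, x ∈ α.dom t⁻¹ ∧ α.act t x = y
  iseqv :=
    { refl := fun x => ⟨1, by rw [inv_one, α.dom_one]; trivial, α.act_one x⟩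
      symm := by
        rintro x y ⟨t, hx, rfl⟩
        exact ⟨t⁻¹, α.act_mem_inv hx, α.act_inv_act hx⟩
      trans := by
        rintro x y z ⟨t, hx, rfl⟩ ⟨s, hy, rfl⟩
        exact ⟨s * t, α.act_mul s t x hx hy⟩ }

/-- The orbit space `X/H`. -/
def OrbitSpace (α : PartialAction H X) : Type _ := Quotient α.orbitSetoid

/-- The orbit map `X → X/H`, `x ↦ Hx`. -/
def orbit (α : PartialAction H X) (x : X) : α.OrbitSpace := Quotient.mk α.orbitSetoid x

/-- The orbit space carries the quotient topology. -/
instance [TopologicalSpace X] (α : PartialAction H X) : TopologicalSpace α.OrbitSpace :=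
  inferInstanceAs (TopologicalSpace (Quotient α.orbitSetoid))

theorem exists_orbit_eq (α : PartialAction H X) (z : α.OrbitSpace) : ∃ x, α.orbit x = z :=
  Quotient.exists_rep z

/-- A chosen point on an orbit. -/
def rep (α : PartialAction H X) (z : α.OrbitSpace) : X := (α.exists_orbit_eq z).choose

theorem orbit_rep (α : PartialAction H X) (z : α.OrbitSpace) : α.orbit (α.rep z) = z :=
  (α.exists_orbit_eq z).choose_spec

theorem orbit_eq_iff (α : PartialAction H X) {x y : X} :
    α.orbit x = α.orbit y ↔ ∃ t, x ∈ α.dom t⁻¹ ∧ α.act t x = y :=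
  Quotient.eq (r := α.orbitSetoid)

end PartialAction

/-! ### Upper semicontinuous `C⋆`-bundles -/

/-- The fibre of `p : B → X` over `x`. It is not given the subspace topology: its only topology
will be that of its norm. -/
def Fiber {B X : Type*} (p : B → X) (x : X) : Type _ := {b : B // p b = x}

namespace Fiber

variable {B X : Type*} {p : B → X}

/-- The point of the total space underlying an element of a fibre. -/
def val {x : X} (b : Fiber p x) : B := Subtype.val b

theorem proj_val {x : X} (b : Fiber p x) : p b.val = x := Subtype.property b

@[ext] theorem ext {x : X} {a b : Fiber p x} (h : a.val = b.val) : a = b := Subtype.ext h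

/-- A point of the total space lying over `x`, as an element of the fibre over `x`. -/
def mk {x : X} (b : B) (h : p b = x) : Fiber p x := ⟨b, h⟩

@[simp] theorem val_mk {x : X} (b : B) (h : p b = x) : (mk b h).val = b := rfl

@[simp] theorem mk_val {x : X} (b : Fiber p x) (h : p b.val = x) : mk b.val h = b := rfl

end Fiber

/-- `p : B → X`, with the given `C⋆`-algebra structures on its fibres, is an upper semicontinuous
`C⋆`-bundle. -/
structure IsUSCCStarBundle {B X : Type*} [TopologicalSpace B] [TopologicalSpace X] (p : B → X)
    [∀ x, NonUnitalCStarAlgebra (Fiber p x)] : Prop where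
  continuous_proj : Continuous p
  isOpenMap_proj : IsOpenMap p
  surjective_proj : Function.Surjective p
  upperSemicontinuous_norm : UpperSemicontinuous fun b : B => ‖Fiber.mk (p := p) b rfl‖
  continuous_add : Continuous fun q : {q : B × B // p q.1 = p q.2} =>
    (Fiber.mk q.1.1 q.2 + Fiber.mk q.1.2 rfl).val
  continuous_smul : ∀ c : ℂ, Continuous fun b : B => (c • Fiber.mk (p := p) b rfl).val
  continuous_mul : Continuous fun q : {q : B × B // p q.1 = p q.2} =>
    (Fiber.mk q.1.1 q.2 * Fiber.mk q.1.2 rfl).val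
  continuous_star : Continuous fun b : B => (star (Fiber.mk (p := p) b rfl)).val
  le_nhds_zero : ∀ (x : X) (l : Filter B), Tendsto p l (𝓝 x) →
    Tendsto (fun b : B => ‖Fiber.mk (p := p) b rfl‖) l (𝓝 0) → l ≤ 𝓝 (0 : Fiber p x).val

namespace IsUSCCStarBundle

theorem norm_mk {B X : Type*} {p : B → X} [∀ x, NonUnitalCStarAlgebra (Fiber p x)] {x : X}
    (b : Fiber p x) : ‖Fiber.mk (p := p) b.val rfl‖ = ‖b‖ := by
  obtain ⟨b, rfl⟩ := b
  rfl

variable {B X : Type*} [TopologicalSpace B] [TopologicalSpace X] {p : B → X}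
  [∀ x, NonUnitalCStarAlgebra (Fiber p x)]

theorem continuous_zero_section (hB : IsUSCCStarBundle p) :
    Continuous fun x => (0 : Fiber p x).val := by
  rw [continuous_iff_continuousAt]
  intro x
  refine hB.le_nhds_zero x (map (fun x => (0 : Fiber p x).val) (𝓝 x)) ?_ ?_
  · rw [tendsto_map'_iff]
    exact tendsto_id.congr fun y => ((0 : Fiber p y).proj_val).symm
  · rw [tendsto_map'_iff]
    refine tendsto_const_nhds.congr fun y => ?_
    simp only [Function.comp_apply]
    rw [norm_mk, norm_zero]

theorem continuous_section_add (hB : IsUSCCStarBundle p) {f g : ∀ x, Fiber p x}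
    (hf : Continuous fun x => (f x).val) (hg : Continuous fun x => (g x).val) :
    Continuous fun x => (f x + g x).val := by
  have key : ∀ (x y : X) (a b : Fiber p x) (h : y = x) (h1 : p a.val = y) (h2 : p b.val = y),
      (Fiber.mk a.val h1 + Fiber.mk b.val h2).val = (a + b).val := by
    rintro x y a b rfl h1 h2; rfl
  refine (hB.continuous_add.comp (Continuous.subtype_mk (hf.prodMk hg) fun x =>
    ((f x).proj_val.trans (g x).proj_val.symm))).congr fun x => ?_
  exact key x _ (f x) (g x) (g x).proj_val _ _

theorem continuous_section_mul (hB : IsUSCCStarBundle p) {f g : ∀ x, Fiber p x}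
    (hf : Continuous fun x => (f x).val) (hg : Continuous fun x => (g x).val) :
    Continuous fun x => (f x * g x).val := by
  have key : ∀ (x y : X) (a b : Fiber p x) (h : y = x) (h1 : p a.val = y) (h2 : p b.val = y),
      (Fiber.mk a.val h1 * Fiber.mk b.val h2).val = (a * b).val := by
    rintro x y a b rfl h1 h2; rfl
  refine (hB.continuous_mul.comp (Continuous.subtype_mk (hf.prodMk hg) fun x =>
    ((f x).proj_val.trans (g x).proj_val.symm))).congr fun x => ?_
  exact key x _ (f x) (g x) (g x).proj_val _ _

theorem continuous_section_smul (hB : IsUSCCStarBundle p) (c : ℂ) {f : ∀ x, Fiber p x}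
    (hf : Continuous fun x => (f x).val) : Continuous fun x => (c • f x).val := by
  have key : ∀ (x y : X) (a : Fiber p x) (h : y = x) (h1 : p a.val = y),
      (c • Fiber.mk a.val h1).val = (c • a).val := by
    rintro x y a rfl h1; rfl
  exact ((hB.continuous_smul c).comp hf).congr fun x => key x _ (f x) (f x).proj_val _

theorem continuous_section_star (hB : IsUSCCStarBundle p) {f : ∀ x, Fiber p x}
    (hf : Continuous fun x => (f x).val) : Continuous fun x => (star (f x)).val := by
  have key : ∀ (x y : X) (a : Fiber p x) (h : y = x) (h1 : p a.val = y),
      (star (Fiber.mk a.val h1)).val = (star a).val := by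
    rintro x y a rfl h1; rfl
  exact (hB.continuous_star.comp hf).congr fun x => key x _ (f x) (f x).proj_val _

theorem isClosed_norm_ge (hB : IsUSCCStarBundle p) {f : ∀ x, Fiber p x}
    (hf : Continuous fun x => (f x).val) (ε : ℝ) : IsClosed {x | ε ≤ ‖f x‖} := by
  have h := (upperSemicontinuous_iff_isClosed_preimage.1 hB.upperSemicontinuous_norm ε).preimage hf
  convert h using 1
  ext x
  simp only [Set.mem_ofPred_eq, Set.mem_preimage, Set.mem_Ici]
  rw [norm_mk]

/-- The algebra `C_b(B)` of bounded continuous sections. Here `lp (Fiber p) ∞` is the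
`C⋆`-algebra of all bounded sections, with pointwise operations and the supremum norm. -/
def boundedSections (hB : IsUSCCStarBundle p) : NonUnitalStarSubalgebra ℂ (lp (Fiber p) ∞) where
  carrier := {f | Continuous fun x => (f x).val}
  add_mem' hf hg := hB.continuous_section_add hf hg
  zero_mem' := hB.continuous_zero_section
  mul_mem' hf hg := hB.continuous_section_mul hf hg
  smul_mem' c _ hf := hB.continuous_section_smul c hf
  star_mem' hf := hB.continuous_section_star hf

/-- The algebra `C_0(B)` of continuous sections vanishing at infinity, that is, such that
`{x | ε ≤ ‖f x‖}` is compact for every `ε > 0` (boundedness is automatic for such sections,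
see `memℓp_of_vanishing`). -/
def zeroSections (hB : IsUSCCStarBundle p) : NonUnitalStarSubalgebra ℂ (lp (Fiber p) ∞) where
  carrier := {f | (Continuous fun x => (f x).val) ∧ ∀ ε : ℝ, 0 < ε → IsCompact {x | ε ≤ ‖f x‖}}
  add_mem' := by
    rintro f g ⟨hf, hf'⟩ ⟨hg, hg'⟩
    have hc := hB.continuous_section_add hf hg
    refine ⟨hc, fun ε hε => ?_⟩
    refine ((hf' (ε / 2) (half_pos hε)).union (hg' (ε / 2) (half_pos hε))).of_isClosed_subset
      (hB.isClosed_norm_ge hc ε) fun x hx => ?_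
    by_contra h
    simp only [Set.mem_union, Set.mem_ofPred_eq, not_or, not_le] at h hx
    have h1 : ‖(f + g : lp (Fiber p) ∞) x‖ ≤ ‖f x‖ + ‖g x‖ := norm_add_le (f x) (g x)
    linarith [h.1, h.2]
  zero_mem' := by
    refine ⟨hB.continuous_zero_section, fun ε hε => ?_⟩
    convert isCompact_empty
    ext x
    simpa using hε
  mul_mem' := by
    rintro f g ⟨hf, hf'⟩ ⟨hg, hg'⟩
    have hc := hB.continuous_section_mul hf hg
    refine ⟨hc, fun ε hε => ?_⟩
    have hp : (0 : ℝ) < ‖f‖ + 1 := by positivity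
    refine (hg' (ε / (‖f‖ + 1)) (div_pos hε hp)).of_isClosed_subset
      (hB.isClosed_norm_ge hc ε) fun x hx => ?_
    simp only [Set.mem_ofPred_eq] at hx ⊢
    rw [div_le_iff₀ hp]
    have h1 : ‖(f * g : lp (Fiber p) ∞) x‖ ≤ ‖f x‖ * ‖g x‖ := norm_mul_le (f x) (g x)
    have h2 := lp.norm_apply_le_norm ENNReal.top_ne_zero f x
    nlinarith [norm_nonneg (g x), norm_nonneg (f x)]
  smul_mem' := by
    rintro c f ⟨hf, hf'⟩
    have hc := hB.continuous_section_smul c hf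
    refine ⟨hc, fun ε hε => ?_⟩
    have hp : (0 : ℝ) < ‖c‖ + 1 := by positivity
    refine (hf' (ε / (‖c‖ + 1)) (div_pos hε hp)).of_isClosed_subset
      (hB.isClosed_norm_ge hc ε) fun x hx => ?_
    simp only [Set.mem_ofPred_eq] at hx ⊢
    have h1 : ‖(c • f : lp (Fiber p) ∞) x‖ = ‖c‖ * ‖f x‖ := norm_smul c (f x)
    rw [div_le_iff₀ hp]
    nlinarith [norm_nonneg (f x)]
  star_mem' := by
    rintro f ⟨hf, hf'⟩
    refine ⟨hB.continuous_section_star hf, fun ε hε => ?_⟩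
    have : {x | ε ≤ ‖(star f : lp (Fiber p) ∞) x‖} = {x | ε ≤ ‖f x‖} := by
      ext x
      simp [lp.star_apply]
    rw [this]
    exact hf' ε hε

theorem memℓp_of_vanishing (hB : IsUSCCStarBundle p) {f : ∀ x, Fiber p x}
    (hf : Continuous fun x => (f x).val)
    (hf' : ∀ ε : ℝ, 0 < ε → IsCompact {x | ε ≤ ‖f x‖}) : Memℓp f ∞ := by
  apply memℓp_infty
  obtain ⟨t, ht⟩ := (hf' 1 one_pos).elim_finite_subcover (fun n : ℕ => {x | (n : ℝ) ≤ ‖f x‖}ᶜ)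
    (fun n => (hB.isClosed_norm_ge hf n).isOpen_compl) fun x _ => by
      obtain ⟨n, hn⟩ := exists_nat_gt ‖f x‖
      exact Set.mem_iUnion.2 ⟨n, by simpa using hn⟩
  refine ⟨1 + ∑ n ∈ t, (n : ℝ), ?_⟩
  rintro _ ⟨x, rfl⟩
  have hs : (0 : ℝ) ≤ ∑ n ∈ t, (n : ℝ) := by positivity
  rcases le_total 1 ‖f x‖ with h | h
  · obtain ⟨n, hn, hx⟩ := Set.mem_iUnion₂.1 (ht h)
    have h1 : (n : ℝ) ≤ ∑ n ∈ t, (n : ℝ) :=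
      Finset.single_le_sum (f := fun n : ℕ => (n : ℝ)) (fun _ _ => Nat.cast_nonneg _) hn
    simp only [Set.mem_compl_iff, Set.mem_ofPred_eq, not_le] at hx
    simp only
    linarith
  · simp only
    linarith

end IsUSCCStarBundle

/-! ### Partial actions on bundles, the orbit bundle -/

/-- A (continuous) partial action of `H` on the bundle `p : B → X`: a pair of continuous partial
actions on the total space and on the base space, such that `p⁻¹(X_t) = B_t`, `p` is a morphism,
and `α_t` restricts to morphisms of `C⋆`-algebras between fibres. -/
structure BundlePartialAction (H : Type*) {B X : Type*} [Group H] [TopologicalSpace H]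
    [TopologicalSpace B] [TopologicalSpace X] (p : B → X)
    [∀ x, NonUnitalCStarAlgebra (Fiber p x)] where
  total : PartialAction H B
  base : PartialAction H X
  total_continuous : total.IsContinuous
  base_continuous : base.IsContinuous
  preimage_dom : ∀ t, p ⁻¹' base.dom t = total.dom t
  proj_morphism : total.IsMorphism base p
  fiber_hom : ∀ t, ∀ x ∈ base.dom t⁻¹, ∃ φ : Fiber p x →⋆ₙₐ[ℂ] Fiber p (base.act t x),
    ∀ b, (φ b).val = total.act t b.val

/-- Transport of a `C⋆`-algebra structure along a bijection. -/
@[reducible] def Equiv.transportCStar {A A' : Type*} [NonUnitalCStarAlgebra A] (e : A' ≃ A) :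
    NonUnitalCStarAlgebra A' :=
  letI r : NonUnitalRing A' := e.nonUnitalRing
  letI m : Module ℂ A' := e.module ℂ
  let φ : A' ≃+* A := e.ringEquiv
  letI n : NonUnitalNormedRing A' := NonUnitalNormedRing.induced A' A φ φ.injective
  letI s : StarRing A' :=
    { star := fun a => e.symm (star (e a))
      star_involutive := fun a => by
        change e.symm (star (e (e.symm (star (e a))))) = a
        simp
      star_mul := fun a b => by
        change e.symm (star (e (e.symm (e a * e b)))) =
          e.symm (e (e.symm (star (e b))) * e (e.symm (star (e a))))
        simp
      star_add := fun a b => by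
        change e.symm (star (e (e.symm (e a + e b)))) =
          e.symm (e (e.symm (star (e a))) + e (e.symm (star (e b))))
        simp }
  have hiso : Isometry e := fun a b => rfl
  have hsmul : ∀ (c : ℂ) (a : A'), c • a = e.symm (c • e a) := fun _ _ => rfl
  have hmul : ∀ a b : A', a * b = e.symm (e a * e b) := fun _ _ => rfl
  have hstar : ∀ a : A', star a = e.symm (star (e a)) := fun _ => rfl
  have hnorm : ∀ a : A', ‖a‖ = ‖e a‖ := fun _ => rfl
  { n, s, m with
    complete := (completeSpace_congr (e := e) hiso.isUniformEmbedding).2 inferInstance |>.complete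
    norm_mul_self_le := fun a => by
      rw [hnorm, hnorm, hmul, hstar]
      simp [CStarRing.norm_star_mul_self]
    norm_smul_le := fun c a => by
      rw [hnorm, hnorm, hsmul, e.apply_symm_apply, norm_smul]
    smul_assoc := fun c a b => by
      simp only [smul_eq_mul, hsmul, hmul, e.apply_symm_apply, smul_mul_assoc]
    smul_comm := fun c a b => by
      simp only [smul_eq_mul, hsmul, hmul, e.apply_symm_apply, mul_smul_comm]
    star_smul := fun c a => by
      simp only [hsmul, hstar, e.apply_symm_apply, star_smul] }

namespace BundlePartialAction

variable {H B X : Type*} [Group H] [TopologicalSpace H]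
    [TopologicalSpace B] [TopologicalSpace X] {p : B → X}
    [∀ x, NonUnitalCStarAlgebra (Fiber p x)]

theorem mem_dom_iff (α : BundlePartialAction H p) {t : H} {b : B} :
    b ∈ α.total.dom t ↔ p b ∈ α.base.dom t := by
  rw [← α.preimage_dom]; rfl

/-- The projection `p_α : B/H → X/H`, `Hb ↦ Hp(b)`. -/
def orbitProj (α : BundlePartialAction H p) : α.total.OrbitSpace → α.base.OrbitSpace :=
  Quotient.map p (by
    rintro a b ⟨t, ha, rfl⟩
    exact ⟨t, α.mem_dom_iff.1 ha, α.proj_morphism.map_act t a ha⟩)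

@[simp] theorem orbitProj_orbit (α : BundlePartialAction H p) (b : B) :
    α.orbitProj (α.total.orbit b) = α.base.orbit (p b) := rfl

/-- The map `h_x : B_x → (B/H)_z`, `b ↦ Hb`, where `z = Hx`. -/
def fiberMap (α : BundlePartialAction H p) {x : X} {z : α.base.OrbitSpace}
    (hz : α.base.orbit x = z) (b : Fiber p x) : Fiber α.orbitProj z :=
  Fiber.mk (α.total.orbit b.val) (by rw [orbitProj_orbit, b.proj_val, hz])

theorem fiberMap_bijective (α : BundlePartialAction H p) [α.base.IsFree] {x : X}
    {z : α.base.OrbitSpace} (hz : α.base.orbit x = z) : Function.Bijective (α.fiberMap hz) := by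
  constructor
  · intro a b hab
    obtain ⟨t, ht, hb⟩ := α.total.orbit_eq_iff.1 (congrArg Fiber.val hab)
    have h1 := α.mem_dom_iff.1 ht
    have h2 := α.proj_morphism.map_act t _ ht
    rw [hb, b.proj_val, a.proj_val] at h2
    rw [a.proj_val] at h1
    obtain rfl := PartialAction.IsFree.eq_one t x h1 h2
    ext
    rw [← hb, α.total.act_one]
  · rintro ⟨c, hc⟩
    induction c using Quotient.ind with
    | _ b =>
      obtain ⟨t, ht, hx⟩ := α.base.orbit_eq_iff.1 (hc.trans hz.symm)
      have hb : b ∈ α.total.dom t⁻¹ := α.mem_dom_iff.2 ht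
      refine ⟨Fiber.mk (α.total.act t b) ?_, ?_⟩
      · rw [← α.proj_morphism.map_act t b hb, hx]
      · apply Fiber.ext
        exact (α.total.orbit_eq_iff.2 ⟨t, hb, rfl⟩).symm

/-- The bijection `h_x : B_x → (B/H)_z`, `z = Hx`, of a free partial action. -/
def fiberEquiv (α : BundlePartialAction H p) [α.base.IsFree] {x : X}
    {z : α.base.OrbitSpace} (hz : α.base.orbit x = z) : Fiber p x ≃ Fiber α.orbitProj z :=
  Equiv.ofBijective (α.fiberMap hz) (α.fiberMap_bijective hz)

/-- The `C⋆`-algebra structure on the fibre of `B/H` over `z`: the one that makes `h_x` an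
isomorphism, for a chosen `x` with `Hx = z`. By `fiberStarEquiv` and `norm_fiberStarEquiv` below,
every `h_x` is then an isometric isomorphism, so that the structure does not depend on the
choice. -/
instance orbitFiberCStar (α : BundlePartialAction H p) [α.base.IsFree] (z : α.base.OrbitSpace) :
    NonUnitalCStarAlgebra (Fiber α.orbitProj z) :=
  (α.fiberEquiv (α.base.orbit_rep z)).symm.transportCStar

theorem exists_fiber_hom (α : BundlePartialAction H p) {x y : X}
    (h : α.base.orbit x = α.base.orbit y) :
    ∃ φ : Fiber p x →⋆ₙₐ[ℂ] Fiber p y, ∀ b, α.total.orbit (φ b).val = α.total.orbit b.val := by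
  obtain ⟨t, ht, rfl⟩ := α.base.orbit_eq_iff.1 h
  obtain ⟨φ, hφ⟩ := α.fiber_hom t x ht
  refine ⟨φ, fun b => ?_⟩
  rw [hφ]
  refine (α.total.orbit_eq_iff.2 ⟨t, α.mem_dom_iff.2 ?_, rfl⟩).symm
  rwa [b.proj_val]

/-- `h_x : B_x → (B/H)_z`, `z = Hx`, as an isomorphism of `C⋆`-algebras. -/
def fiberStarEquiv (α : BundlePartialAction H p) [α.base.IsFree] {x : X}
    {z : α.base.OrbitSpace} (hz : α.base.orbit x = z) :
    Fiber p x ≃⋆ₐ[ℂ] Fiber α.orbitProj z :=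
  have hy : α.base.orbit (α.base.rep z) = z := α.base.orbit_rep z
  have key : ∃ φ : Fiber p x →⋆ₙₐ[ℂ] Fiber p (α.base.rep z),
      ∀ b, α.fiberEquiv hz b = α.fiberEquiv hy (φ b) := by
    obtain ⟨φ, hφ⟩ := α.exists_fiber_hom (hz.trans hy.symm)
    exact ⟨φ, fun b => Fiber.ext (hφ b).symm⟩
  { α.fiberEquiv hz with
    map_mul' := fun a b => by
      obtain ⟨φ, hφ⟩ := key
      change α.fiberEquiv hz (a * b) = α.fiberEquiv hy
        ((α.fiberEquiv hy).symm (α.fiberEquiv hz a) * (α.fiberEquiv hy).symm (α.fiberEquiv hz b))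
      simp [hφ]
    map_add' := fun a b => by
      obtain ⟨φ, hφ⟩ := key
      change α.fiberEquiv hz (a + b) = α.fiberEquiv hy
        ((α.fiberEquiv hy).symm (α.fiberEquiv hz a) + (α.fiberEquiv hy).symm (α.fiberEquiv hz b))
      simp [hφ]
    map_star' := fun a => by
      obtain ⟨φ, hφ⟩ := key
      change α.fiberEquiv hz (star a) = α.fiberEquiv hy
        (star ((α.fiberEquiv hy).symm (α.fiberEquiv hz a)))
      simp [hφ, map_star]
    map_smul' := fun c a => by
      obtain ⟨φ, hφ⟩ := key
      change α.fiberEquiv hz (c • a) = α.fiberEquiv hy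
        (c • (α.fiberEquiv hy).symm (α.fiberEquiv hz a))
      simp [hφ] }

theorem fiberStarEquiv_val (α : BundlePartialAction H p) [α.base.IsFree] {x : X}
    {z : α.base.OrbitSpace} (hz : α.base.orbit x = z) (b : Fiber p x) :
    (α.fiberStarEquiv hz b).val = α.total.orbit b.val := rfl

theorem norm_fiberStarEquiv (α : BundlePartialAction H p) [α.base.IsFree] {x : X}
    {z : α.base.OrbitSpace} (hz : α.base.orbit x = z) (b : Fiber p x) :
    ‖α.fiberStarEquiv hz b‖ = ‖b‖ :=
  NonUnitalStarAlgHom.norm_map (α.fiberStarEquiv hz) (α.fiberStarEquiv hz).injective b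

/-! ### The induced algebras -/

theorem isMorphism_section_iff (α : BundlePartialAction H p) {f : ∀ x, Fiber p x} :
    (α.base.IsMorphism α.total fun x => (f x).val) ↔
      (Continuous fun x => (f x).val) ∧ ∀ t, ∀ x, x ∈ α.base.dom t⁻¹ →
        ∀ φ : Fiber p x →⋆ₙₐ[ℂ] Fiber p (α.base.act t x),
          (∀ b, (φ b).val = α.total.act t b.val) → φ (f x) = f (α.base.act t x) := by
  constructor
  · rintro ⟨h1, -, h3⟩
    exact ⟨h1, fun t x hx φ hφ => Fiber.ext ((hφ _).trans (h3 t x hx))⟩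
  · rintro ⟨h1, h2⟩
    refine ⟨h1, fun t x hx => ?_, fun t x hx => ?_⟩
    · rw [α.mem_dom_iff, (f x).proj_val]
      exact hx
    · obtain ⟨φ, hφ⟩ := α.fiber_hom t x hx
      rw [← hφ, h2 t x hx φ hφ]

/-- The induced algebra `Ind_b(B, α)`: the sections in `C_b(B)` that are morphisms of partial
actions from the base space to the total space. -/
def indBounded (α : BundlePartialAction H p) (hB : IsUSCCStarBundle p) :
    NonUnitalStarSubalgebra ℂ (lp (Fiber p) ∞) where
  carrier := {f | f ∈ hB.boundedSections ∧ α.base.IsMorphism α.total fun x => (f x).val}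
  add_mem' := by
    rintro f g ⟨hf, hf'⟩ ⟨hg, hg'⟩
    rw [isMorphism_section_iff] at hf' hg'
    refine ⟨add_mem hf hg, α.isMorphism_section_iff.2 ⟨add_mem hf hg, fun t x hx φ hφ => ?_⟩⟩
    exact (map_add φ (f x) (g x)).trans
      (congrArg₂ (· + ·) (hf'.2 t x hx φ hφ) (hg'.2 t x hx φ hφ))
  zero_mem' := by
    refine ⟨zero_mem _, α.isMorphism_section_iff.2
      ⟨zero_mem hB.boundedSections, fun t x hx φ hφ => ?_⟩⟩
    exact map_zero φ
  mul_mem' := by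
    rintro f g ⟨hf, hf'⟩ ⟨hg, hg'⟩
    rw [isMorphism_section_iff] at hf' hg'
    refine ⟨mul_mem hf hg, α.isMorphism_section_iff.2 ⟨mul_mem hf hg, fun t x hx φ hφ => ?_⟩⟩
    exact (map_mul φ (f x) (g x)).trans
      (congrArg₂ (· * ·) (hf'.2 t x hx φ hφ) (hg'.2 t x hx φ hφ))
  smul_mem' := by
    rintro c f ⟨hf, hf'⟩
    have hc := SMulMemClass.smul_mem c hf
    rw [isMorphism_section_iff] at hf'
    refine ⟨hc, α.isMorphism_section_iff.2 ⟨hc, fun t x hx φ hφ => ?_⟩⟩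
    exact (map_smul φ c (f x)).trans (congrArg (c • ·) (hf'.2 t x hx φ hφ))
  star_mem' := by
    rintro f ⟨hf, hf'⟩
    rw [isMorphism_section_iff] at hf'
    refine ⟨star_mem hf, α.isMorphism_section_iff.2 ⟨star_mem hf, fun t x hx φ hφ => ?_⟩⟩
    exact (map_star φ (f x)).trans (congrArg star (hf'.2 t x hx φ hφ))

/-- The section `Hx ↦ Hf(x)` of `B/H` induced by a section `f` that is a morphism of partial
actions. -/
def indSection (α : BundlePartialAction H p) (f : ∀ x, Fiber p x)
    (hf : α.base.IsMorphism α.total fun x => (f x).val) (z : α.base.OrbitSpace) :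
    Fiber α.orbitProj z :=
  Fiber.mk
    (Quotient.lift (fun x => α.total.orbit (f x).val) (by
      rintro x y ⟨t, hx, rfl⟩
      refine α.total.orbit_eq_iff.2 ⟨t, ?_, hf.map_act t x hx⟩
      rw [α.mem_dom_iff, (f x).proj_val]
      exact hx) z)
    (by
      induction z using Quotient.ind with
      | _ x =>
        change α.orbitProj (α.total.orbit (f x).val) = α.base.orbit x
        rw [orbitProj_orbit, (f x).proj_val])

theorem indSection_orbit (α : BundlePartialAction H p) [α.base.IsFree] (f : ∀ x, Fiber p x)
    (hf : α.base.IsMorphism α.total fun x => (f x).val) {x : X} {z : α.base.OrbitSpace}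
    (hz : α.base.orbit x = z) : α.indSection f hf z = α.fiberStarEquiv hz (f x) := by
  subst hz
  rfl

theorem memℓp_indSection (α : BundlePartialAction H p) [α.base.IsFree] (hB : IsUSCCStarBundle p)
    (f : α.indBounded hB) : Memℓp (α.indSection f.1 f.2.2) ∞ :=
  memℓp_infty ⟨‖f.1‖, by
    rintro _ ⟨z, rfl⟩
    simp only
    rw [α.indSection_orbit f.1 f.2.2 (α.base.orbit_rep z), norm_fiberStarEquiv]
    exact lp.norm_apply_le_norm ENNReal.top_ne_zero f.1 _⟩

/-- The map `Ind_b`, `f ↦ (Hx ↦ Hf(x))`, as a `⋆`-homomorphism from `Ind_b(B, α)` to the algebra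
of all bounded (not necessarily continuous) sections of `B/H`. -/
def indHom (α : BundlePartialAction H p) [α.base.IsFree] (hB : IsUSCCStarBundle p) :
    α.indBounded hB →⋆ₙₐ[ℂ] lp (Fiber α.orbitProj) ∞ where
  toFun f := ⟨α.indSection f.1 f.2.2, α.memℓp_indSection hB f⟩
  map_smul' c f := by
    ext1; funext z
    have hz := α.base.orbit_rep z
    refine (α.indSection_orbit (c • f).1 (c • f).2.2 hz).trans ((map_smul (α.fiberStarEquiv hz) c _).trans ?_)
    exact congrArg (c • ·) (α.indSection_orbit f.1 f.2.2 hz).symm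
  map_zero' := by
    ext1; funext z
    have hz := α.base.orbit_rep z
    exact (α.indSection_orbit (0 : α.indBounded hB).1 (0 : α.indBounded hB).2.2 hz).trans (map_zero (α.fiberStarEquiv hz))
  map_add' f g := by
    ext1; funext z
    have hz := α.base.orbit_rep z
    refine (α.indSection_orbit (f + g).1 (f + g).2.2 hz).trans ((map_add (α.fiberStarEquiv hz) _ _).trans ?_)
    exact congrArg₂ (· + ·) (α.indSection_orbit f.1 f.2.2 hz).symm
      (α.indSection_orbit g.1 g.2.2 hz).symm
  map_mul' f g := by
    ext1; funext z
    have hz := α.base.orbit_rep z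
    refine (α.indSection_orbit (f * g).1 (f * g).2.2 hz).trans ((map_mul (α.fiberStarEquiv hz) _ _).trans ?_)
    exact congrArg₂ (· * ·) (α.indSection_orbit f.1 f.2.2 hz).symm
      (α.indSection_orbit g.1 g.2.2 hz).symm
  map_star' f := by
    ext1; funext z
    have hz := α.base.orbit_rep z
    refine (α.indSection_orbit (star f).1 (star f).2.2 hz).trans ((map_star (α.fiberStarEquiv hz) _).trans ?_)
    exact congrArg star (α.indSection_orbit f.1 f.2.2 hz).symm

/-- The induced algebra `Ind_0(B, α)`: the preimage of `C_0(B/H)` under `Ind_b`. -/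
def indZero (α : BundlePartialAction H p) [α.base.IsFree] (hB : IsUSCCStarBundle p)
    (hQ : IsUSCCStarBundle α.orbitProj) : NonUnitalStarSubalgebra ℂ (α.indBounded hB) :=
  NonUnitalStarSubalgebra.comap (α.indHom hB) hQ.zeroSections

end BundlePartialAction

end

/-! Freeness makes each `B_x` a copy of the fibre of `B/H` over `Hx`. The maps `α_t` between fibres
are `⋆`-homomorphisms that respect orbits, so the algebra structure does not depend on the chosen
`x`, and injective `⋆`-homomorphisms of `C⋆`-algebras are isometric. Orbit maps of continuous
partial actions are open quotient maps, so the norm, scalar multiples and the involution descend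
from `B` to `B/H` with their (semi)continuity.

Addition and multiplication live on pairs in a common fibre, and here properness is needed. By
compactness and freeness, an element of `H` that moves a point near `x` to a point near `x` is close
to `1` (`IsProper.exists_nhds_forall_mem`). Hence a point near `b` can be translated into a
prescribed nearby fibre on the same orbit without leaving a given neighbourhood of `b`
(`exists_nhds_translate`). It follows that the orbit map on such pairs is an open quotient map
(`isOpenQuotientMap_orbitPair`).

The same translation gives surjectivity of `Ind_b`: a section `F` of `B/H` has exactly one lift to
`B` over `X`, and that lift is continuous if `F` is (`exists_indHom_eq`). `Ind_b` is isometric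
because it is so fibrewise, and the section algebras are norm closed because uniform limits of
continuous sections are continuous (`continuous_of_uniform_limit`). -/

namespace PartialAction

/-! ### Orbit maps, and the local consequence of freeness and properness -/

variable {H X : Type*} [Group H]

theorem mem_dom_one_inv (α : PartialAction H X) (x : X) : x ∈ α.dom (1 : H)⁻¹ := by
  rw [inv_one, α.dom_one]; trivial

theorem orbit_act (α : PartialAction H X) {t : H} {x : X} (hx : x ∈ α.dom t⁻¹) :
    α.orbit (α.act t x) = α.orbit x :=
  (α.orbit_eq_iff.2 ⟨t, hx, rfl⟩).symm

theorem continuous_orbit [TopologicalSpace X] (α : PartialAction H X) : Continuous α.orbit :=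
  continuous_quotient_mk'

theorem surjective_orbit (α : PartialAction H X) : Function.Surjective α.orbit :=
  α.exists_orbit_eq

variable [TopologicalSpace H] [TopologicalSpace X]

theorem IsContinuous.continuousAt {α : PartialAction H X} (hα : α.IsContinuous) {t : H} {x : X}
    (hx : x ∈ α.dom t⁻¹) : ContinuousAt (fun q : H × X => α.act q.1 q.2) (t, x) :=
  hα.continuousOn.continuousAt (hα.isOpen_graphDomain.mem_nhds hx)

/-- If `α_t` moves `y` into an open set `U`, then `α_t` is defined near `y` and moves all points
near `y` into `U`; so the saturation of `U` is open. -/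
theorem IsContinuous.isOpenMap_orbit {α : PartialAction H X} (hα : α.IsContinuous) :
    IsOpenMap α.orbit := by
  intro U hU
  refine isOpen_coinduced.2 (isOpen_iff_mem_nhds.2 ?_)
  rintro y ⟨x, hx, hxy⟩
  obtain ⟨t, ht, rfl⟩ := α.orbit_eq_iff.1 (Eq.symm hxy : α.orbit y = α.orbit x)
  have hc : Tendsto (fun z : X => (t, z)) (𝓝 y) (𝓝 (t, y)) :=
    (Continuous.prodMk_right t).tendsto y
  filter_upwards [hc.eventually (hα.isOpen_graphDomain.mem_nhds ht),
    ((hα.continuousAt ht).tendsto.comp hc).eventually (hU.mem_nhds hx)] with z hz hzU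
  exact ⟨α.act t z, hzU, α.orbit_act hz⟩

theorem IsContinuous.isOpenQuotientMap_orbit {α : PartialAction H X} (hα : α.IsContinuous) :
    IsOpenQuotientMap α.orbit :=
  ⟨α.surjective_orbit, α.continuous_orbit, hα.isOpenMap_orbit⟩

/-- For a free and proper partial action, an element that moves a point near `x` to a point near
`x` is close to the identity. -/
theorem IsProper.exists_nhds_forall_mem [LocallyCompactSpace X] [T2Space X]
    {α : PartialAction H X} [α.IsFree] (hα : α.IsContinuous) (hp : α.IsProper) (x : X)
    {W : Set H} (hW : W ∈ 𝓝 1) :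
    ∃ N ∈ 𝓝 x, ∀ y ∈ N, ∀ t, y ∈ α.dom t⁻¹ → α.act t y ∈ N → t ∈ W := by
  set F : H × X → X × X := fun q => (q.2, α.act q.1 q.2)
  -- The filter is that of pairs `(t, y)` in `Γ` for which both `y` and `α_t(y)` tend to `x`; the
  -- claim is that `t` then tends to `1`.
  suffices h : Tendsto Prod.fst (𝓟 α.graphDomain ⊓ comap F (𝓝 (x, x))) (𝓝 (1 : H)) by
    have h1 := h hW
    rw [mem_map, inf_comm, mem_inf_principal', nhds_prod_eq] at h1
    obtain ⟨s, hs, hsub⟩ := mem_comap.1 (mem_of_superset h1 (fun _ h => h))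
    obtain ⟨N, hN, hNs⟩ := mem_prod_same_iff.1 hs
    refine ⟨N, hN, fun y hy t ht hty => ?_⟩
    have h2 := hsub (show (t, y) ∈ F ⁻¹' s from hNs ⟨hy, hty⟩)
    exact h2.resolve_left (fun h => h ht)
  -- A finer ultrafilter contains the preimage of `K ×ˢ K`, with `K` a compact neighbourhood of `x`.
  -- This preimage is compact, so the ultrafilter converges to some `(t, y)` in `Γ`. As `X` is
  -- Hausdorff, continuity forces `y = x` and `α_t(x) = x`, and freeness gives `t = 1`.
  rw [tendsto_iff_ultrafilter]
  intro g hg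
  obtain ⟨K, hK, hKx⟩ := exists_compact_mem_nhds x
  have hgΓ : α.graphDomain ∈ (g : Filter (H × X)) := le_principal_iff.1 (hg.trans inf_le_left)
  have hgF : Tendsto F g (𝓝 (x, x)) := tendsto_iff_comap.2 (hg.trans inf_le_right)
  have hgC : {q : H × X | q ∈ α.graphDomain ∧ (q.2, α.act q.1 q.2) ∈ K ×ˢ K} ∈
      (g : Filter (H × X)) :=
    inter_mem hgΓ (hgF (prod_mem_nhds hKx hKx))
  obtain ⟨⟨t, y⟩, ⟨hty, -⟩, hle⟩ :=
    (hp _ (hK.prod hK)).ultrafilter_le_nhds g (le_principal_iff.2 hgC)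
  have h1 : Tendsto F g (𝓝 (F (t, y))) :=
    (continuous_snd.continuousAt.prodMk (hα.continuousAt hty)).tendsto.mono_left hle
  have h2 : (y, α.act t y) = (x, x) := tendsto_nhds_unique h1 hgF
  obtain ⟨rfl, h3⟩ := Prod.mk.inj h2
  obtain rfl := IsFree.eq_one t y hty h3
  exact continuous_fst.continuousAt.tendsto.mono_left hle

end PartialAction

/-! ### Convergence in a bundle and completeness of the section algebras -/

namespace IsUSCCStarBundle

variable {B X : Type*} [TopologicalSpace B] [TopologicalSpace X] {p : B → X}
  [∀ x, NonUnitalCStarAlgebra (Fiber p x)]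

theorem map_proj_nhds (hB : IsUSCCStarBundle p) (b : B) : map p (𝓝 b) = 𝓝 (p b) :=
  le_antisymm hB.continuous_proj.continuousAt (hB.isOpenMap_proj.nhds_le b)

/-- A form of continuity of addition for summands whose base point varies along a filter. The points
`p (v i).val` and `y i` are only propositionally equal, which `key` absorbs. -/
theorem tendsto_add (hB : IsUSCCStarBundle p) {ι : Type*} {l : Filter ι} {y : ι → X}
    {u v : ∀ i, Fiber p (y i)} {x : X} {a b : Fiber p x}
    (hu : Tendsto (fun i => (u i).val) l (𝓝 a.val))
    (hv : Tendsto (fun i => (v i).val) l (𝓝 b.val)) :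
    Tendsto (fun i => (u i + v i).val) l (𝓝 (a + b).val) := by
  have key : ∀ (x y : X) (a b : Fiber p x) (h : y = x) (h1 : p a.val = y) (h2 : p b.val = y),
      (Fiber.mk a.val h1 + Fiber.mk b.val h2).val = (a + b).val := by
    rintro x y a b rfl h1 h2; rfl
  have h1 : Tendsto (fun i => (⟨((u i).val, (v i).val),
      (u i).proj_val.trans (v i).proj_val.symm⟩ : {q : B × B // p q.1 = p q.2})) l
      (𝓝 ⟨(a.val, b.val), a.proj_val.trans b.proj_val.symm⟩) :=
    tendsto_subtype_rng.2 (hu.prodMk_nhds hv)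
  have h2 := (hB.continuous_add.tendsto _).comp h1
  rw [key x _ a b b.proj_val] at h2
  exact h2.congr fun i => key _ _ (u i) (v i) (v i).proj_val _ _

theorem tendsto_smul (hB : IsUSCCStarBundle p) (c : ℂ) {ι : Type*} {l : Filter ι} {y : ι → X}
    {u : ∀ i, Fiber p (y i)} {x : X} {a : Fiber p x}
    (hu : Tendsto (fun i => (u i).val) l (𝓝 a.val)) :
    Tendsto (fun i => (c • u i).val) l (𝓝 (c • a).val) := by
  have key : ∀ (x y : X) (a : Fiber p x) (h : y = x) (h1 : p a.val = y),
      (c • Fiber.mk a.val h1).val = (c • a).val := by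
    rintro x y a rfl h1; rfl
  have h2 := ((hB.continuous_smul c).tendsto _).comp hu
  rw [key x _ a a.proj_val] at h2
  exact h2.congr fun i => key _ _ (u i) (u i).proj_val _

theorem tendsto_sub (hB : IsUSCCStarBundle p) {ι : Type*} {l : Filter ι} {y : ι → X}
    {u v : ∀ i, Fiber p (y i)} {x : X} {a b : Fiber p x}
    (hu : Tendsto (fun i => (u i).val) l (𝓝 a.val))
    (hv : Tendsto (fun i => (v i).val) l (𝓝 b.val)) :
    Tendsto (fun i => (u i - v i).val) l (𝓝 (a - b).val) := by
  have h := hB.tendsto_add hu (hB.tendsto_smul (-1) hv)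
  simpa only [neg_one_smul, ← sub_eq_add_neg] using h

theorem eventually_norm_lt (hB : IsUSCCStarBundle p) {ι : Type*} {l : Filter ι} {y : ι → X}
    {u : ∀ i, Fiber p (y i)} {x : X} {a : Fiber p x}
    (hu : Tendsto (fun i => (u i).val) l (𝓝 a.val)) {ε : ℝ} (h : ‖a‖ < ε) :
    ∀ᶠ i in l, ‖u i‖ < ε := by
  have h1 := hu.eventually (hB.upperSemicontinuous_norm a.val ε ((norm_mk a).trans_lt h))
  filter_upwards [h1] with i hi
  rwa [norm_mk] at hi

/-- The uniform limit of continuous sections is continuous. -/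
theorem continuous_of_uniform_limit (hB : IsUSCCStarBundle p) {f : ∀ x, Fiber p x}
    (h : ∀ ε : ℝ, 0 < ε → ∃ g : ∀ x, Fiber p x, (Continuous fun x => (g x).val) ∧
      ∀ x, ‖f x - g x‖ < ε) : Continuous fun x => (f x).val := by
  rw [continuous_iff_continuousAt]
  intro x
  have hpx : p (f x).val = x := (f x).proj_val
  have hp : Tendsto p (𝓝 (f x).val) (𝓝 x) := by
    simpa only [hpx] using hB.continuous_proj.tendsto (f x).val
  have hid : Tendsto (fun b : B => (Fiber.mk (p := p) b rfl).val) (𝓝 (f x).val)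
      (𝓝 (f x).val) := tendsto_id
  -- As `b` tends to `f x`, `b - g (p b)` tends to `f x - g x`, of norm below `ε / 2`, so its norm
  -- is eventually below `ε / 2` by upper semicontinuity. Hence `b - f (p b)` has norm eventually
  -- below `ε`, and it tends to the zero over `x` by the bundle axiom on small nets.
  have h0 : Tendsto (fun b : B => (Fiber.mk (p := p) b rfl - f (p b)).val) (𝓝 (f x).val)
      (𝓝 (0 : Fiber p x).val) := by
    refine hB.le_nhds_zero x _ ?_ ?_
    · rw [tendsto_map'_iff]
      exact hp.congr fun b => (Fiber.proj_val _).symm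
    · rw [tendsto_map'_iff]
      refine Metric.tendsto_nhds.2 fun ε hε => ?_
      obtain ⟨g, hg, hfg⟩ := h (ε / 2) (half_pos hε)
      filter_upwards [hB.eventually_norm_lt
        (hB.tendsto_sub hid ((hg.tendsto x).comp hp)) (hfg x)] with b hb
      simp only [Function.comp_apply, norm_mk, dist_zero_right, norm_norm]
      have h1 := norm_sub_le_norm_sub_add_norm_sub (Fiber.mk (p := p) b rfl) (g (p b)) (f (p b))
      have h2 := hfg (p b)
      rw [norm_sub_rev] at h2
      have h3 : ‖Fiber.mk (p := p) b rfl - g (p b)‖ < ε / 2 := hb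
      linarith
  -- Thus `f (p b) = b - (b - f (p b))` tends to `f x`. Since `p` is open and continuous, it carries
  -- the neighbourhood filter of `f x` to that of `x`, which turns this into continuity of `f` at
  -- `x`.
  have h1 := hB.tendsto_sub hid h0
  simp only [sub_sub_cancel, sub_zero] at h1
  have h2 : Tendsto (fun x => (f x).val) (map p (𝓝 (f x).val)) (𝓝 (f x).val) := h1
  rwa [hB.map_proj_nhds, hpx] at h2

theorem isClosed_boundedSections (hB : IsUSCCStarBundle p) :
    IsClosed (hB.boundedSections : Set (lp (Fiber p) ∞)) := by
  refine isClosed_of_closure_subset fun f hf => hB.continuous_of_uniform_limit fun ε hε => ?_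
  obtain ⟨g, hg, hfg⟩ := Metric.mem_closure_iff.1 hf ε hε
  refine ⟨g, hg, fun x => lt_of_le_of_lt ?_ (dist_eq_norm f g ▸ hfg)⟩
  exact lp.norm_apply_le_norm ENNReal.top_ne_zero (f - g) x

theorem isClosed_zeroSections (hB : IsUSCCStarBundle p) :
    IsClosed (hB.zeroSections : Set (lp (Fiber p) ∞)) := by
  refine isClosed_of_closure_subset fun f hf => ?_
  have hc : Continuous fun x => (f x).val :=
    hB.isClosed_boundedSections.closure_subset_iff.2 (fun g hg => hg.1) hf
  refine ⟨hc, fun ε hε => ?_⟩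
  obtain ⟨g, hg, hfg⟩ := Metric.mem_closure_iff.1 hf (ε / 2) (half_pos hε)
  refine (hg.2 (ε / 2) (half_pos hε)).of_isClosed_subset (hB.isClosed_norm_ge hc ε) fun x hx => ?_
  have h1 : ‖f x - g x‖ ≤ ‖f - g‖ := lp.norm_apply_le_norm ENNReal.top_ne_zero (f - g) x
  have h2 := norm_le_norm_add_norm_sub' (f x) (g x)
  rw [dist_eq_norm] at hfg
  simp only [Set.mem_ofPred_eq] at hx ⊢
  linarith

/-- The axiom on small nets, applied to the coarsest filter along which `p` tends to `x` and the
norm tends to `0`: its basic sets are tubes over neighbourhoods of `x`. -/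
theorem exists_nhds_norm_lt_mem (hB : IsUSCCStarBundle p) {x : X} {V : Set B}
    (hV : V ∈ 𝓝 (0 : Fiber p x).val) :
    ∃ N ∈ 𝓝 x, ∃ ε : ℝ, 0 < ε ∧ ∀ y ∈ N, ∀ b : Fiber p y, ‖b‖ < ε → b.val ∈ V := by
  have h := hB.le_nhds_zero x
    (comap p (𝓝 x) ⊓ comap (fun b : B => ‖Fiber.mk (p := p) b rfl‖) (𝓝 0))
    (tendsto_comap.mono_left inf_le_left) (tendsto_comap.mono_left inf_le_right) hV
  obtain ⟨s, ⟨N, hN, hs⟩, t, ⟨T, hT, ht⟩, rfl⟩ := mem_inf_iff.1 h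
  obtain ⟨ε, hε, hεT⟩ := Metric.mem_nhds_iff.1 hT
  refine ⟨N, hN, ε, hε, fun y hy b hb => ⟨hs ?_, ht (hεT ?_)⟩⟩
  · simpa only [Set.mem_preimage, b.proj_val] using hy
  · simpa only [Metric.mem_ball, dist_zero_right, norm_norm, norm_mk] using hb

end IsUSCCStarBundle

/-! ### The orbit bundle -/

namespace BundlePartialAction

variable {H B X : Type*} [Group H] [TopologicalSpace H] [TopologicalSpace B] [TopologicalSpace X]
  {p : B → X} [∀ x, NonUnitalCStarAlgebra (Fiber p x)]

/-- A point near `b` can be moved along its orbit, staying near `b`, into the fibre over any point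
near `p b` on the orbit of its projection. -/
theorem exists_nhds_translate [LocallyCompactSpace X] [T2Space X] (hB : IsUSCCStarBundle p)
    (α : BundlePartialAction H p) [α.base.IsFree] (hproper : α.base.IsProper) {b : B} {V : Set B}
    (hV : V ∈ 𝓝 b) :
    ∃ V' ∈ 𝓝 b, ∃ N ∈ 𝓝 (p b), ∀ b' ∈ V', ∀ y ∈ N, α.base.orbit (p b') = α.base.orbit y →
      ∃ c ∈ V, p c = y ∧ α.total.orbit c = α.total.orbit b' := by
  -- Elements of `H` in some `W` near `1` keep points of some `V'` inside `V`; freeness and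
  -- properness then ensure that the element carrying `p b'` to `y` lies in `W`.
  have h1 : Tendsto (fun q : H × B => α.total.act q.1 q.2) (𝓝 1 ×ˢ 𝓝 b) (𝓝 b) := by
    simpa only [nhds_prod_eq, α.total.act_one] using
      (α.total_continuous.continuousAt (α.total.mem_dom_one_inv b)).tendsto
  obtain ⟨W, hW, V', hV', hWV⟩ := mem_prod_iff.1 (h1 hV)
  obtain ⟨N, hN, hNW⟩ := hproper.exists_nhds_forall_mem α.base_continuous (p b) hW
  refine ⟨V' ∩ p ⁻¹' N, inter_mem hV' (hB.continuous_proj.continuousAt hN), N, hN, ?_⟩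
  rintro b' ⟨hb', hbN⟩ y hy h
  obtain ⟨t, ht, rfl⟩ := α.base.orbit_eq_iff.1 h
  have htb : b' ∈ α.total.dom t⁻¹ := α.mem_dom_iff.2 ht
  exact ⟨α.total.act t b', hWV (Set.mk_mem_prod (hNW _ hbN t ht hy) hb'),
    (α.proj_morphism.map_act t b' htb).symm, α.total.orbit_act htb⟩

theorem norm_orbit (α : BundlePartialAction H p) [α.base.IsFree] (b : B) :
    ‖Fiber.mk (p := α.orbitProj) (α.total.orbit b) rfl‖ = ‖Fiber.mk (p := p) b rfl‖ := by
  rw [← norm_fiberStarEquiv α rfl (Fiber.mk (p := p) b rfl)]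
  rfl

/-- The orbit map on pairs of points in the same fibre. -/
def orbitPair (α : BundlePartialAction H p) (q : {q : B × B // p q.1 = p q.2}) :
    {q : α.total.OrbitSpace × α.total.OrbitSpace // α.orbitProj q.1 = α.orbitProj q.2} :=
  ⟨(α.total.orbit q.1.1, α.total.orbit q.1.2), congrArg α.base.orbit q.2⟩

/-- Continuity on `B/H` of addition and multiplication can be tested on `B` only if orbits over a
common point lift to nearby points of a common fibre. Surjectivity comes from the fibre bijections,
openness from `exists_nhds_translate`. -/
theorem isOpenQuotientMap_orbitPair [LocallyCompactSpace X] [T2Space X]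
    (hB : IsUSCCStarBundle p) (α : BundlePartialAction H p) [α.base.IsFree]
    (hproper : α.base.IsProper) : IsOpenQuotientMap α.orbitPair := by
  refine ⟨?_, ?_, IsOpenMap.of_nhds_le ?_⟩
  · rintro ⟨⟨z, w⟩, h⟩
    obtain ⟨a, rfl⟩ := α.total.exists_orbit_eq z
    obtain ⟨b, hb⟩ := (α.fiberMap_bijective (rfl : α.base.orbit (p a) = _)).2
      (Fiber.mk (p := α.orbitProj) w h.symm)
    exact ⟨⟨(a, b.val), b.proj_val.symm⟩,
      Subtype.ext (Prod.ext rfl (congrArg Fiber.val hb))⟩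
  · exact Continuous.subtype_mk
      ((α.total.continuous_orbit.comp (continuous_fst.comp continuous_subtype_val)).prodMk
        (α.total.continuous_orbit.comp (continuous_snd.comp continuous_subtype_val))) _
  · rintro ⟨⟨a, b⟩, hab⟩ S hS
    rw [mem_map, nhds_induced, mem_comap, nhds_prod_eq] at hS
    obtain ⟨T, hT, hTS⟩ := hS
    obtain ⟨U, hU, V, hV, hUV⟩ := mem_prod_iff.1 hT
    obtain ⟨V', hV', N, hN, key⟩ := α.exists_nhds_translate hB hproper hV
    replace hab : p a = p b := hab
    rw [← hab] at hN
    have ho := α.total_continuous.isOpenMap_orbit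
    rw [nhds_induced, mem_comap]
    refine ⟨_, prod_mem_nhds
      (ho.image_mem_nhds (inter_mem hU (hB.continuous_proj.continuousAt hN)))
      (ho.image_mem_nhds hV'), ?_⟩
    rintro ⟨⟨_, _⟩, h⟩ ⟨⟨a', ⟨ha', haN⟩, rfl⟩, ⟨b', hb', rfl⟩⟩
    -- The representatives `a'` and `b'` may lie in different fibres over the same orbit; `b'` is
    -- replaced by a translate `c` in the fibre of `a'` that is still in `V`.
    obtain ⟨c, hc, hpc, hcb⟩ := key b' hb' (p a') haN h.symm
    have hS : α.orbitPair ⟨(a', c), hpc.symm⟩ ∈ S :=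
      hTS (show (⟨(a', c), hpc.symm⟩ : {q : B × B // p q.1 = p q.2}) ∈ _ from
        hUV (Set.mk_mem_prod ha' hc))
    have heq : α.orbitPair ⟨(a', c), hpc.symm⟩ = ⟨(α.total.orbit a', α.total.orbit b'), h⟩ :=
      Subtype.ext (congrArg (Prod.mk (α.total.orbit a')) hcb)
    exact heq ▸ hS

/-- Semicontinuity of the norm and continuity of the operations are tested after composition with
open quotient maps, where the isometric isomorphisms `fiberStarEquiv` reduce them to the same
conditions on `B`. -/
theorem isUSCCStarBundle_orbitProj [LocallyCompactSpace X] [T2Space X]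
    (hB : IsUSCCStarBundle p) (α : BundlePartialAction H p) [α.base.IsFree]
    (hproper : α.base.IsProper) : IsUSCCStarBundle α.orbitProj := by
  have hqB := α.total_continuous.isOpenQuotientMap_orbit
  have hqX := α.base_continuous.isOpenQuotientMap_orbit
  have hpair := α.isOpenQuotientMap_orbitPair hB hproper
  constructor
  · exact hqB.isQuotientMap.continuous_iff.2 (hqX.continuous.comp hB.continuous_proj)
  · intro U hU
    have : α.orbitProj '' U = α.base.orbit '' (p '' (α.total.orbit ⁻¹' U)) := by
      conv_lhs => rw [← Set.image_preimage_eq U hqB.surjective]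
      simp only [Set.image_image, orbitProj_orbit]
    rw [this]
    exact hqX.isOpenMap _ (hB.isOpenMap_proj _ (hU.preimage hqB.continuous))
  · intro z
    obtain ⟨x, rfl⟩ := hqX.surjective z
    obtain ⟨b, rfl⟩ := hB.surjective_proj x
    exact ⟨α.total.orbit b, rfl⟩
  · rw [upperSemicontinuous_iff_isOpen_preimage]
    intro r
    rw [← hqB.isQuotientMap.isOpen_preimage]
    convert upperSemicontinuous_iff_isOpen_preimage.1 hB.upperSemicontinuous_norm r using 1
    ext b
    simp only [Set.mem_preimage, norm_orbit]
  · refine hpair.isQuotientMap.continuous_iff.2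
      ((hqB.continuous.comp hB.continuous_add).congr ?_)
    rintro ⟨⟨a, b⟩, h⟩
    exact congrArg Fiber.val
      (map_add (α.fiberStarEquiv (rfl : α.base.orbit (p b) = _)) (Fiber.mk a h) (Fiber.mk b rfl))
  · intro c
    refine hqB.isQuotientMap.continuous_iff.2
      ((hqB.continuous.comp (hB.continuous_smul c)).congr fun b => ?_)
    exact congrArg Fiber.val
      (map_smul (α.fiberStarEquiv (rfl : α.base.orbit (p b) = _)) c (Fiber.mk b rfl))
  · refine hpair.isQuotientMap.continuous_iff.2
      ((hqB.continuous.comp hB.continuous_mul).congr ?_)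
    rintro ⟨⟨a, b⟩, h⟩
    exact congrArg Fiber.val
      (map_mul (α.fiberStarEquiv (rfl : α.base.orbit (p b) = _)) (Fiber.mk a h) (Fiber.mk b rfl))
  · refine hqB.isQuotientMap.continuous_iff.2
      ((hqB.continuous.comp hB.continuous_star).congr fun b => ?_)
    exact congrArg Fiber.val
      (map_star (α.fiberStarEquiv (rfl : α.base.orbit (p b) = _)) (Fiber.mk b rfl))
  -- Openness of the orbit map provides, for `w` over a point near `Hx`, a point `y` near `x` on the
  -- orbit below `w`. The lift of `w` to `B_y` has the same norm as `w`, so it lies in a tube inside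
  -- the preimage of `V`.
  · intro z l hl hl0 V hV
    obtain ⟨x, rfl⟩ := hqX.surjective z
    have h0 : (0 : Fiber α.orbitProj (α.base.orbit x)).val =
        α.total.orbit (0 : Fiber p x).val :=
      congrArg Fiber.val (map_zero (α.fiberStarEquiv (rfl : α.base.orbit x = _))).symm
    rw [h0] at hV
    obtain ⟨N, hN, ε, hε, key⟩ :=
      hB.exists_nhds_norm_lt_mem (hqB.continuous.continuousAt hV)
    filter_upwards [hl (hqX.isOpenMap.image_mem_nhds hN), hl0 (gt_mem_nhds hε)] with w hw hwε
    obtain ⟨y, hy, hyw⟩ := hw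
    obtain ⟨b, hb⟩ : ∃ b, α.fiberStarEquiv hyw b = Fiber.mk w rfl :=
      (α.fiberEquiv hyw).surjective _
    have hwb : α.total.orbit b.val = w := congrArg Fiber.val hb
    rw [← hwb]
    refine key y hy b ?_
    rw [← norm_fiberStarEquiv α hyw, hb]
    exact hwε

/-! ### The induced algebras and the isomorphism `Ind_b` -/

theorem norm_indHom (α : BundlePartialAction H p) [α.base.IsFree] (hB : IsUSCCStarBundle p)
    (f : α.indBounded hB) : ‖α.indHom hB f‖ = ‖f‖ := by
  refine le_antisymm (lp.norm_le_of_forall_le (norm_nonneg _) fun z => ?_)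
    (lp.norm_le_of_forall_le (norm_nonneg _) fun x => ?_)
  · change ‖α.indSection f.1 f.2.2 z‖ ≤ _
    rw [α.indSection_orbit f.1 f.2.2 (α.base.orbit_rep z), norm_fiberStarEquiv]
    exact lp.norm_apply_le_norm ENNReal.top_ne_zero f.1 _
  · refine le_of_eq_of_le (α.norm_fiberStarEquiv (rfl : α.base.orbit x = _) (f.1 x)).symm ?_
    exact lp.norm_apply_le_norm ENNReal.top_ne_zero (α.indHom hB f) (α.base.orbit x)

theorem isometry_indHom (α : BundlePartialAction H p) [α.base.IsFree]
    (hB : IsUSCCStarBundle p) : Isometry (α.indHom hB) :=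
  AddMonoidHomClass.isometry_of_norm _ (α.norm_indHom hB)

/-- In the form of `isMorphism_section_iff`, equivariance is an equation between elements of a
normed fibre. Evaluations and `⋆`-homomorphisms are contractive, so it passes to norm limits,
although `B` itself is not assumed Hausdorff. -/
theorem isClosed_indBounded (α : BundlePartialAction H p) (hB : IsUSCCStarBundle p) :
    IsClosed (α.indBounded hB : Set (lp (Fiber p) ∞)) := by
  have heval : ∀ x, Continuous fun f : lp (Fiber p) ∞ => f x := fun x =>
    (LipschitzWith.of_dist_le_mul (K := 1) fun f g => by
      rw [NNReal.coe_one, one_mul, dist_eq_norm, dist_eq_norm]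
      exact lp.norm_apply_le_norm ENNReal.top_ne_zero (f - g) x).continuous
  refine isClosed_of_closure_subset fun f hf => ?_
  have hc : f ∈ hB.boundedSections :=
    hB.isClosed_boundedSections.closure_subset_iff.2 (fun g hg => hg.1) hf
  refine ⟨hc, α.isMorphism_section_iff.2 ⟨hc, fun t x hx φ hφ => ?_⟩⟩
  exact (isClosed_eq ((AddMonoidHomClass.continuous_of_bound φ 1 fun a =>
    (NonUnitalStarAlgHom.norm_apply_le φ a).trans_eq (one_mul _).symm).comp (heval x)) (heval _)).closure_subset_iff.2
    (fun g hg => (α.isMorphism_section_iff.1 hg.2).2 t x hx φ hφ) hf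

theorem continuous_indSection (α : BundlePartialAction H p)
    (f : ∀ x, Fiber p x) (hf : α.base.IsMorphism α.total fun x => (f x).val) :
    Continuous fun z => (α.indSection f hf z).val :=
  Continuous.quotient_lift (α.total.continuous_orbit.comp hf.continuous) _

/-- The preimage is forced: `f x` must be the only point of `B_x` on the orbit `F (Hx)`. This
uniqueness yields both continuity and equivariance. -/
theorem exists_indHom_eq [LocallyCompactSpace X] [T2Space X] (hB : IsUSCCStarBundle p)
    (α : BundlePartialAction H p) [α.base.IsFree] (hproper : α.base.IsProper)
    (F : lp (Fiber α.orbitProj) ∞) (hF : Continuous fun z => (F z).val) :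
    ∃ f : α.indBounded hB, α.indHom hB f = F := by
  set f : ∀ x, Fiber p x := fun x => (α.fiberStarEquiv rfl).symm (F (α.base.orbit x))
  have hfF : ∀ x, α.fiberStarEquiv rfl (f x) = F (α.base.orbit x) := fun x =>
    (α.fiberStarEquiv rfl).apply_symm_apply _
  have horb : ∀ x, α.total.orbit (f x).val = (F (α.base.orbit x)).val := fun x =>
    congrArg Fiber.val (hfF x)
  have hunique : ∀ x (b : B), p b = x → α.total.orbit b = (F (α.base.orbit x)).val →
      b = (f x).val := by
    rintro _ b rfl h
    exact congrArg Fiber.val ((α.fiberMap_bijective (rfl : α.base.orbit (p b) = _)).1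
      (Fiber.ext (h.trans (horb _).symm) :
        α.fiberMap rfl (Fiber.mk b rfl) = α.fiberMap rfl (f (p b))))
  have hcont : Continuous fun x => (f x).val := by
    -- For `y` near `x`, the orbit `F (Hy)` meets `V'`, possibly in a fibre other than `B_y`.
    -- Translating that point into `B_y` keeps it in `V`, and by uniqueness the result is `f y`.
    refine continuous_iff_continuousAt.2 fun x V hV => ?_
    obtain ⟨V', hV', N, hN, key⟩ := α.exists_nhds_translate hB hproper hV
    rw [(f x).proj_val] at hN
    have h1 : ContinuousAt (fun y => (F (α.base.orbit y)).val) x :=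
      (hF.comp α.base.continuous_orbit).continuousAt
    have h2 := α.total_continuous.isOpenMap_orbit.image_mem_nhds hV'
    rw [horb] at h2
    change ∀ᶠ y in 𝓝 x, (f y).val ∈ V
    filter_upwards [hN, h1.eventually h2] with y hy hyF
    obtain ⟨b', hb', hbF⟩ := hyF
    have h3 : α.base.orbit (p b') = α.base.orbit y :=
      (congrArg α.orbitProj hbF).trans (Fiber.proj_val _)
    obtain ⟨c, hc, hpc, hcb⟩ := key b' hb' y hy h3
    rw [← hunique y c hpc (hcb.trans hbF)]
    exact hc
  have hmor : α.base.IsMorphism α.total fun x => (f x).val := by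
    refine α.isMorphism_section_iff.2 ⟨hcont, fun t x hx φ hφ => Fiber.ext ?_⟩
    -- The translate of `f x` by `t` lies over `t · x` on the orbit `F (Hx) = F (H(t · x))`, so it
    -- is `f (t · x)`.
    refine hunique _ _ (Fiber.proj_val _) ?_
    have hd : (f x).val ∈ α.total.dom t⁻¹ := by
      rwa [α.mem_dom_iff, (f x).proj_val]
    rw [hφ, α.total.orbit_act hd, α.base.orbit_act hx, horb]
  have hbdd : Memℓp f ∞ := memℓp_infty ⟨‖F‖, by
    rintro _ ⟨x, rfl⟩
    change ‖f x‖ ≤ ‖F‖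
    rw [← norm_fiberStarEquiv α (rfl : α.base.orbit x = _), hfF]
    exact lp.norm_apply_le_norm ENNReal.top_ne_zero F _⟩
  refine ⟨⟨⟨f, hbdd⟩, hcont, hmor⟩, ?_⟩
  ext1; funext z
  obtain ⟨x, rfl⟩ := α.base.exists_orbit_eq z
  exact hfF x

end BundlePartialAction

/-! ### The main theorem -/

theorem mainTheorem6 {H B X : Type*} [Group H] [TopologicalSpace H] [IsTopologicalGroup H]
    [LocallyCompactSpace H] [T2Space H] [TopologicalSpace X] [LocallyCompactSpace X] [T2Space X]
    [TopologicalSpace B] (p : B → X) [∀ x, NonUnitalCStarAlgebra (Fiber p x)]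
    (hB : IsUSCCStarBundle p) (α : BundlePartialAction H p) [α.base.IsFree]
    (hproper : α.base.IsProper) :
    -- every `h_x : B_x → (B/H)_{Hx}`, `b ↦ Hb`, is an isomorphism of `C⋆`-algebras
    (∀ x : X, ∃ h : Fiber p x ≃⋆ₐ[ℂ] Fiber α.orbitProj (α.base.orbit x),
      Isometry h ∧ ∀ b, (h b).val = α.total.orbit b.val) ∧
    -- `B/H` is an upper semicontinuous `C⋆`-bundle over `X/H`
    ∃ hQ : IsUSCCStarBundle α.orbitProj,
      -- the algebras involved are `C⋆`-algebras (norm closed in the algebras of bounded sections)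
      IsClosed (α.indBounded hB : Set (lp (Fiber p) ∞)) ∧
      IsClosed (α.indZero hB hQ : Set (α.indBounded hB)) ∧
      IsClosed (hQ.boundedSections : Set (lp (Fiber α.orbitProj) ∞)) ∧
      IsClosed (hQ.zeroSections : Set (lp (Fiber α.orbitProj) ∞)) ∧
      -- `Ind_b : Ind_b(B, α) → C_b(B/H)` is an isomorphism of `C⋆`-algebras
      (∃ Φ : α.indBounded hB ≃⋆ₐ[ℂ] hQ.boundedSections, Isometry Φ ∧
        (∀ f, (Φ f : lp (Fiber α.orbitProj) ∞) = α.indHom hB f) ∧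
        ∀ (f : α.indBounded hB) (x : X),
          ((Φ f : lp (Fiber α.orbitProj) ∞) (α.base.orbit x)).val =
            α.total.orbit ((f : lp (Fiber p) ∞) x).val) ∧
      -- its restriction `Ind_0 : Ind_0(B, α) → C_0(B/H)` is an isomorphism of `C⋆`-algebras
      (∃ Ψ : α.indZero hB hQ ≃⋆ₐ[ℂ] hQ.zeroSections, Isometry Ψ ∧
        ∀ f : α.indZero hB hQ,
          (Ψ f : lp (Fiber α.orbitProj) ∞) = α.indHom hB (f : α.indBounded hB)) := by
  have hQ := α.isUSCCStarBundle_orbitProj hB hproper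
  refine ⟨fun x => ⟨α.fiberStarEquiv rfl,
      AddMonoidHomClass.isometry_of_norm _ (α.norm_fiberStarEquiv rfl), fun b => rfl⟩,
    hQ, α.isClosed_indBounded hB,
    hQ.isClosed_zeroSections.preimage (α.isometry_indHom hB).continuous,
    hQ.isClosed_boundedSections, hQ.isClosed_zeroSections, ?_, ?_⟩
  · let Φ : α.indBounded hB →⋆ₙₐ[ℂ] hQ.boundedSections :=
      NonUnitalStarAlgHom.codRestrict (α.indHom hB) hQ.boundedSections
        fun f => α.continuous_indSection f.1 f.2.2
    have hiso : Isometry Φ := fun f g => α.isometry_indHom hB f g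
    have hsurj : Function.Surjective Φ := fun F => by
      obtain ⟨f, hf⟩ := α.exists_indHom_eq hB hproper F.1 F.2
      exact ⟨f, Subtype.ext hf⟩
    exact ⟨StarAlgEquiv.ofBijective Φ ⟨hiso.injective, hsurj⟩, hiso, fun f => rfl,
      fun f x => rfl⟩
  · let Ψ : α.indZero hB hQ →⋆ₙₐ[ℂ] hQ.zeroSections :=
      NonUnitalStarAlgHom.codRestrict
        ((α.indHom hB).comp (NonUnitalStarSubalgebraClass.subtype (α.indZero hB hQ)))
        hQ.zeroSections fun f => f.2
    have hiso : Isometry Ψ := fun f g => α.isometry_indHom hB f g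
    -- An element of `C_0(B/H)` is bounded and continuous, so it has a preimage under `Ind_b`, which
    -- lies in `Ind_0(B, α)` because that algebra is the full preimage of `C_0(B/H)`.
    have hsurj : Function.Surjective Ψ := fun F => by
      obtain ⟨f, hf⟩ := α.exists_indHom_eq hB hproper F.1 F.2.1
      have hmem : α.indHom hB f ∈ hQ.zeroSections := hf ▸ F.2
      exact ⟨⟨f, hmem⟩, Subtype.ext hf⟩
    exact ⟨StarAlgEquiv.ofBijective Ψ ⟨hiso.injective, hsurj⟩, hiso, fun f => rfl⟩
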